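/- **Theorem (Uniform Empirical Bernstein Inequality for Random Walks).** There is an absolute constant $C_3>0$ such that the following holds. Let $P,Q$ be probability distributions on $\mathbb R^d$ with finite means, and let $X_1,X_2,\dots\sim P$ and $Y_1,Y_2,\dots\sim Q$ be jointly independent random vectors. Put $$h_i=(X_{2i-1}-Y_{2i-1})^\top(X_{2i}-Y_{2i}),\qquad T_n=\sum_{i=1}^n h_i,\qquad \widehat V_n=\sum_{i=1}^n h_i^2 .$$ Assume the null hypothesis $H_0:\ \mathbb E_{X\sim P}[X]=\mathbb E_{Y\sim Q}[Y]$, and assume that $|h_i|\le 1$ almost surely for all $i$ (which holds in particular if $\|X\|,\|Y\|\le \tfrac12$ almost surely). Then for every $\xi>0$, with probability at least $1-\xi$, simultaneously for all $n$, $$|T_n|<C_0(\xi)+\sqrt{2\,\widehat V_n^{*}\Big([\ln\ln]_+\big(\widehat V_n^{*}\big)+\ln\tfrac4\xi\Big)},$$ where $\widehat V_n^{*}:=C_3\big(\widehat V_n+C_0(\xi)\big)$, $[\ln\ln]_+(x):=\ln\ln\max(x,e^e)$ and $$C_0(\xi)=3(e-2)e^2+2\Big(1+\sqrt{\tfrac13}\Big)\ln\tfrac8\xi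 .$$ -/

import Mathlib

open MeasureTheory ProbabilityTheory

noncomputable section

namespace TwoSample

/-- The increment `⟪X_{2i-1} - Y_{2i-1}, X_{2i} - Y_{2i}⟫`, with samples and increments indexed
from `0` instead of `1`: `X k` is the sample `X_{k+1}` and `incr X Y i` is `h_{i+1}`. -/
def incr {Ω : Type*} {d : ℕ} (X Y : ℕ → Ω → EuclideanSpace ℝ (Fin d)) (i : ℕ) (ω : Ω) : ℝ :=
  inner ℝ (X (2 * i) ω - Y (2 * i) ω) (X (2 * i + 1) ω - Y (2 * i + 1) ω)

/-- The test statistic `T_n`, the sum of the first `n` increments. -/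
def stat {Ω : Type*} {d : ℕ} (X Y : ℕ → Ω → EuclideanSpace ℝ (Fin d)) (n : ℕ) (ω : Ω) : ℝ :=
  ∑ i ∈ Finset.range n, incr X Y i ω

/-- The empirical variance process, the sum of the squares of the first `n` increments. -/
def empVar {Ω : Type*} {d : ℕ} (X Y : ℕ → Ω → EuclideanSpace ℝ (Fin d)) (n : ℕ) (ω : Ω) : ℝ :=
  ∑ i ∈ Finset.range n, incr X Y i ω ^ 2

/-- `[ln ln]₊ x = ln ln (max x e^e)`. -/
def lnlnPlus (x : ℝ) : ℝ :=
  Real.log (Real.log (max x (Real.exp (Real.exp 1))))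

/-- `C₀(ξ) = 3 (e - 2) e² + 2 (1 + √(1/3)) ln (8 / ξ)`. -/
def C₀ (ξ : ℝ) : ℝ :=
  3 * (Real.exp 1 - 2) * Real.exp 1 ^ 2 + 2 * (1 + √(1 / 3)) * Real.log (8 / ξ)

/-- `V*_n = C₃ (V̂_n + C₀(ξ))`. -/
def empVarStar {Ω : Type*} {d : ℕ} (C₃ ξ : ℝ) (X Y : ℕ → Ω → EuclideanSpace ℝ (Fin d))
    (n : ℕ) (ω : Ω) : ℝ :=
  C₃ * (empVar X Y n ω + C₀ ξ)

/-- Data of norm at most `1/2` have increments bounded by `1`. -/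
theorem abs_incr_le_one {Ω : Type*} {d : ℕ} (X Y : ℕ → Ω → EuclideanSpace ℝ (Fin d)) (ω : Ω)
    (hX : ∀ k, ‖X k ω‖ ≤ 1 / 2) (hY : ∀ k, ‖Y k ω‖ ≤ 1 / 2) (i : ℕ) :
    |incr X Y i ω| ≤ 1 := by
  have key : ∀ k, ‖X k ω - Y k ω‖ ≤ 1 := fun k =>
    (norm_sub_le _ _).trans (by linarith [hX k, hY k])
  exact (abs_real_inner_le_norm _ _).trans
    (mul_le_one₀ (key _) (norm_nonneg _) (key _))

end TwoSample

end

namespace TwoSample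

/-! The increments are independent, centred and bounded by 1. For |λ| ≤ 1/2, `exp_sub_sq_le_one_add`
bounds exp(λT - λ²V̂) by ∏ (1 + λh_i), a nonnegative martingale of mean one, so Ville's inequality
gives λT - λ²V̂ < ln(1/δ) for all times at once, outside an event of probability δ. The empirical
variance enters directly; no concentration of V̂ is needed. A union bound over λ = ±2^{-(k+1)}
(`measure_not_forall_scale_le`) then allows λ to depend on the data. With S = V̂ + C₀ and A = [ln
ln]₊(S) + ln(4/ξ), the choice λ ≈ √(A/S) balances both terms (`lt_sqrt_of_forall_scale`); the price
ln((k+1)(k+2)) of scale k is of iterated-logarithm order because 4^k ≤ S. -/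

/-- Grouping a jointly independent family into blocks yields independent blocks. -/
theorem iIndepFun_curry {Ω ι : Type*} {κ : ι → Type*} {𝓧 : (i : ι) → κ i → Type*}
    {mΩ : MeasurableSpace Ω} {m𝓧 : ∀ i j, MeasurableSpace (𝓧 i j)} {μ : Measure Ω}
    {X : (i : ι) → (j : κ i) → Ω → 𝓧 i j} (mX : ∀ i j, Measurable (X i j))
    (h : iIndepFun (fun (p : (i : ι) × κ i) ω ↦ X p.1 p.2 ω) μ) :
    iIndepFun (fun i ω ↦ (X i · ω)) μ := by
  have := h.isProbabilityMeasure
  have : ∀ i j, IsProbabilityMeasure (μ.map (X i j)) :=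
    fun i j ↦ Measure.isProbabilityMeasure_map (mX i j).aemeasurable
  have hrow : ∀ i, iIndepFun (X i) μ := fun i ↦
    h.precomp (g := fun j : κ i ↦ (⟨i, j⟩ : (i : ι) × κ i)) sigma_mk_injective
  have hcurry : (MeasurableEquiv.piCurry 𝓧) ∘ (fun ω p ↦ X p.1 p.2 ω) = fun ω i j ↦ X i j ω := by
    ext; simp [Sigma.curry]
  rw [iIndepFun_iff_map_fun_eq_infinitePi_map (by fun_prop), ← hcurry,
    ← Measure.map_map (by fun_prop) (by fun_prop),
    (iIndepFun_iff_map_fun_eq_infinitePi_map (by fun_prop)).1 h,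
    Measure.infinitePi_map_piCurry (fun i j ↦ μ.map (X i j))]
  congrm Measure.infinitePi fun i ↦ ?_
  rw [(iIndepFun_iff_map_fun_eq_infinitePi_map (by fun_prop)).1 (hrow i)]

/-- For x ≥ 0, use e^y ≤ 1 + y + y² at y = x - x² ≤ x; for x = -t, multiply the quadratic lower
bound for e^(t + t²) by 1 - t. -/
theorem exp_sub_sq_le_one_add {x : ℝ} (hx : |x| ≤ 1 / 2) : Real.exp (x - x ^ 2) ≤ 1 + x := by
  obtain ⟨h1, h2⟩ := abs_le.1 hx
  rcases le_total 0 x with h0 | h0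
  · have hy : |x - x ^ 2| ≤ 1 := abs_le.2 ⟨by nlinarith, by nlinarith⟩
    have := (abs_le.1 (Real.abs_exp_sub_one_sub_id_le hy)).2
    have hsq : (x - x ^ 2) ^ 2 ≤ x ^ 2 := pow_le_pow_left₀ (by nlinarith) (by nlinarith) 2
    linarith
  · obtain ⟨t, rfl⟩ : ∃ t, x = -t := ⟨-x, by ring⟩
    have ht0 : 0 ≤ t := by linarith
    have ht : t ≤ 1 / 2 := by linarith
    have hq := Real.quadratic_le_exp_of_nonneg (x := t + t ^ 2) (by positivity)
    rw [show -t - (-t) ^ 2 = -(t + t ^ 2) by ring, Real.exp_neg,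
      inv_le_iff_one_le_mul₀ (Real.exp_pos _)]
    have ht2 : t ^ 2 ≤ 1 / 4 := by nlinarith
    have ht3 : t ^ 3 ≤ 1 / 4 := by nlinarith
    have hpos : 0 ≤ t ^ 2 * (1 - t - t ^ 2 - t ^ 3) := mul_nonneg (sq_nonneg t) (by linarith)
    calc (1 : ℝ) ≤ 1 + 1 / 2 * (t ^ 2 * (1 - t - t ^ 2 - t ^ 3)) := by linarith
      _ = (1 + -t) * (1 + (t + t ^ 2) + (t + t ^ 2) ^ 2 / 2) := by ring
      _ ≤ (1 + -t) * Real.exp (t + t ^ 2) := mul_le_mul_of_nonneg_left hq (by linarith)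

/-! ### Product martingales and Ville's inequality -/

section Martingale

variable {Ω : Type*} {mΩ : MeasurableSpace Ω} {μ : Measure Ω} {g : ℕ → Ω → ℝ}

/-- Products of independent bounded variables of mean one form a martingale. -/
theorem martingale_prod (hg : ∀ i, StronglyMeasurable (g i)) (hind : iIndepFun g μ)
    {K : ℝ} (hbdd : ∀ i ω, |g i ω| ≤ K) (hmean : ∀ i, ∫ ω, g i ω ∂μ = 1) :
    Martingale (fun n ω ↦ ∏ i ∈ Finset.range (n + 1), g i ω) (Filtration.natural g hg) μ := by
  have := hind.isProbabilityMeasure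
  have hadp : StronglyAdapted (Filtration.natural g hg)
      (fun n ω ↦ ∏ i ∈ Finset.range (n + 1), g i ω) := fun n ↦
    Finset.stronglyMeasurable_fun_prod _ fun i hi ↦
      (Filtration.stronglyAdapted_natural hg i).mono
        ((Filtration.natural g hg).mono (Nat.lt_succ_iff.1 (Finset.mem_range.1 hi)))
  have hint : ∀ n, Integrable (fun ω ↦ ∏ i ∈ Finset.range (n + 1), g i ω) μ := fun n ↦
    Integrable.of_bound
      ((hadp n).mono ((Filtration.natural g hg).le n)).aestronglyMeasurable (K ^ (n + 1))
      (Filter.Eventually.of_forall fun ω ↦ by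
        rw [Real.norm_eq_abs, Finset.abs_prod]
        calc ∏ i ∈ Finset.range (n + 1), |g i ω| ≤ ∏ _i ∈ Finset.range (n + 1), K :=
              Finset.prod_le_prod (fun i _ ↦ abs_nonneg _) fun i _ ↦ hbdd i ω
          _ = K ^ (n + 1) := by simp)
  refine martingale_nat hadp hint fun n ↦ ?_
  have hsucc : (fun ω ↦ ∏ i ∈ Finset.range (n + 1 + 1), g i ω) =
      (fun ω ↦ ∏ i ∈ Finset.range (n + 1), g i ω) * g (n + 1) := by
    ext ω
    simp [Finset.prod_range_succ _ (n + 1)]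
  have hg1 : Integrable (g (n + 1)) μ :=
    Integrable.of_bound (hg _).aestronglyMeasurable K (Filter.Eventually.of_forall (hbdd _))
  have hpull := condExp_mul_of_stronglyMeasurable_left (hadp n) (hsucc ▸ hint (n + 1)) hg1
  have hcond := hind.condExp_natural_ae_eq_of_lt hg (Nat.lt_succ_self n)
  rw [hsucc]
  filter_upwards [hpull, hcond] with ω h1 h2
  rw [h1, Pi.mul_apply, h2, hmean, mul_one]

/-- **Ville inequality** for products of independent nonnegative bounded variables of mean one. -/
theorem measure_exists_le_prod_le (hg : ∀ i, StronglyMeasurable (g i)) (hind : iIndepFun g μ)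
    {K : ℝ} (hnonneg : ∀ i ω, 0 ≤ g i ω) (hbdd : ∀ i ω, g i ω ≤ K)
    (hmean : ∀ i, ∫ ω, g i ω ∂μ = 1) {δ : ℝ} (hδ : 0 < δ) :
    μ {ω | ∃ n, δ⁻¹ ≤ ∏ i ∈ Finset.range (n + 1), g i ω} ≤ ENNReal.ofReal δ := by
  have := hind.isProbabilityMeasure
  set f : ℕ → Ω → ℝ := fun n ω ↦ ∏ i ∈ Finset.range (n + 1), g i ω with hf
  have hmart : Martingale f (Filtration.natural g hg) μ :=
    martingale_prod hg hind (fun i ω ↦ (abs_of_nonneg (hnonneg i ω)).trans_le (hbdd i ω)) hmean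
  have hf0 : 0 ≤ f := fun n ω ↦ Finset.prod_nonneg fun i _ ↦ hnonneg i ω
  have hfint : ∀ n, ∫ ω, f n ω ∂μ = 1 := fun n ↦ by
    have := hmart.setIntegral_eq (Nat.zero_le n) MeasurableSet.univ
    rw [setIntegral_univ, setIntegral_univ] at this
    rw [← this]
    simpa [hf] using hmean 0
  have hfin : ∀ n, μ {ω | δ⁻¹ ≤ (Finset.range (n + 1)).sup' Finset.nonempty_range_add_one
      fun k ↦ f k ω} ≤ ENNReal.ofReal δ := fun n ↦ by
    have hmax := maximal_ineq hmart.submartingale hf0 (ε := (δ⁻¹).toNNReal) n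
    rw [Real.coe_toNNReal _ (inv_nonneg.2 hδ.le)] at hmax
    have hle := hmax.trans (ENNReal.ofReal_le_ofReal
      (setIntegral_le_integral (hmart.integrable n) (Filter.Eventually.of_forall (hf0 n))))
    rw [hfint, ENNReal.ofReal_one] at hle
    change ENNReal.ofReal δ⁻¹ * _ ≤ 1 at hle
    rw [ENNReal.ofReal_inv_of_pos hδ, mul_comm] at hle
    simpa using (ENNReal.le_div_iff_mul_le (by simp) (by simp [hδ])).2 hle
  -- The events for the running maxima increase, so the finite-horizon bound passes to the union.
  have hset : {ω | ∃ n, δ⁻¹ ≤ f n ω} = ⋃ n, {ω | δ⁻¹ ≤ (Finset.range (n + 1)).sup'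
      Finset.nonempty_range_add_one fun k ↦ f k ω} := by
    ext ω
    simp only [Set.mem_ofPred_eq, Set.mem_iUnion, Finset.le_sup'_iff, Finset.mem_range]
    exact ⟨fun ⟨n, hn⟩ ↦ ⟨n, n, n.lt_succ_self, hn⟩, fun ⟨_, k, _, hk⟩ ↦ ⟨k, hk⟩⟩
  rw [hset, Monotone.measure_iUnion]
  · exact iSup_le hfin
  · intro m n hmn ω hω
    simp only [Set.mem_ofPred_eq, Finset.le_sup'_iff, Finset.mem_range] at hω ⊢
    obtain ⟨k, hk, h⟩ := hω
    exact ⟨k, by lia, h⟩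

/-- A self-normalised maximal inequality at a fixed scale. -/
theorem measure_exists_le_mul_sum_sub_le (hg : ∀ i, Measurable (g i)) (hind : iIndepFun g μ)
    (hbdd : ∀ i ω, |g i ω| ≤ 1) (hmean : ∀ i, ∫ ω, g i ω ∂μ = 0)
    {l : ℝ} (hl : |l| ≤ 1 / 2) {δ : ℝ} (hδ : 0 < δ) :
    μ {ω | ∃ n, Real.log δ⁻¹ ≤ l * ∑ i ∈ Finset.range (n + 1), g i ω -
      l ^ 2 * ∑ i ∈ Finset.range (n + 1), g i ω ^ 2} ≤ ENNReal.ofReal δ := by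
  have := hind.isProbabilityMeasure
  have habs : ∀ i ω, |l * g i ω| ≤ 1 / 2 := fun i ω ↦ by
    rw [abs_mul]
    nlinarith [hbdd i ω, abs_nonneg (g i ω), abs_nonneg l]
  refine (measure_mono ?_).trans (measure_exists_le_prod_le (μ := μ) (g := fun i ω ↦ 1 + l * g i ω)
    (fun i ↦ Measurable.stronglyMeasurable (by fun_prop))
    (hind.comp (fun _ x ↦ 1 + l * x) (fun _ ↦ by fun_prop)) (K := 2)
    (fun i ω ↦ by linarith [(abs_le.1 (habs i ω)).1])
    (fun i ω ↦ by linarith [(abs_le.1 (habs i ω)).2]) (fun i ↦ ?_) hδ)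
  · rintro ω ⟨n, hn⟩
    refine ⟨n, ?_⟩
    calc δ⁻¹ = Real.exp (Real.log δ⁻¹) := (Real.exp_log (inv_pos.2 hδ)).symm
      _ ≤ Real.exp (l * ∑ i ∈ Finset.range (n + 1), g i ω -
          l ^ 2 * ∑ i ∈ Finset.range (n + 1), g i ω ^ 2) := Real.exp_le_exp.2 hn
      _ = ∏ i ∈ Finset.range (n + 1), Real.exp (l * g i ω - (l * g i ω) ^ 2) := by
          rw [← Real.exp_sum, Finset.sum_sub_distrib, Finset.mul_sum, Finset.mul_sum]
          simp only [mul_pow]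
      _ ≤ _ := Finset.prod_le_prod (fun _ _ ↦ (Real.exp_pos _).le)
          fun i _ ↦ exp_sub_sq_le_one_add (habs i ω)
  · have hgi : Integrable (g i) μ :=
      Integrable.of_bound (hg i).aestronglyMeasurable 1 (Filter.Eventually.of_forall (hbdd i))
    rw [integral_add (integrable_const _) (hgi.const_mul l), integral_const_mul, hmean]
    simp

end Martingale

/-! ### The iterated logarithm and the choice of scale -/

theorem one_le_lnlnPlus (x : ℝ) : 1 ≤ lnlnPlus x := by
  have h : Real.exp 1 ≤ Real.log (max x (Real.exp (Real.exp 1))) := by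
    rw [Real.le_log_iff_exp_le (lt_max_of_lt_right (Real.exp_pos _))]
    exact le_max_right _ _
  rwa [lnlnPlus, Real.le_log_iff_exp_le ((Real.exp_pos _).trans_le h)]

theorem lnlnPlus_mono {x y : ℝ} (hxy : x ≤ y) : lnlnPlus x ≤ lnlnPlus y := by
  have h : 0 < Real.log (max x (Real.exp (Real.exp 1))) :=
    Real.log_pos ((Real.one_lt_exp_iff.2 (Real.exp_pos _)).trans_le (le_max_right _ _))
  exact Real.log_le_log h (Real.log_le_log (lt_max_of_lt_right (Real.exp_pos _))
    (max_le_max_right _ hxy))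

/-- Ensures A ≤ S, so that √(A/S) ≤ 1 lies in the range of the dyadic scales. -/
theorem lnlnPlus_le_div_three {x : ℝ} (hx : 3 ≤ x) : lnlnPlus x ≤ x / 3 := by
  rcases le_total x (Real.exp (Real.exp 1)) with h | h
  · rw [lnlnPlus, max_eq_right h, Real.log_exp, Real.log_exp]
    linarith
  · have h1 : 1 < Real.exp (Real.exp 1) := Real.one_lt_exp_iff.2 (Real.exp_pos _)
    have hlog : 0 < Real.log x := Real.log_pos (h1.trans_le h)
    rw [lnlnPlus, max_eq_left h]
    have h2 := Real.log_le_sub_one_of_pos hlog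
    have h3 := Real.log_le_sub_one_of_pos (show 0 < x / 3 by linarith)
    have h4 := Real.log_le_sub_one_of_pos (show (0 : ℝ) < 3 by norm_num)
    rw [Real.log_div (by linarith) (by norm_num)] at h3
    linarith

/-- Over dyadic scales up to `√x`, the logarithm of the scale index is controlled by
`lnlnPlus x`. -/
theorem log_scale_le {x : ℝ} {k : ℕ} (hx : 4 ^ k ≤ x) :
    Real.log ((k + 1) * (k + 2)) ≤ 4 * lnlnPlus x := by
  set s := Real.log (max x (Real.exp (Real.exp 1))) with hs
  have hmax : 0 < max x (Real.exp (Real.exp 1)) := lt_max_of_lt_right (Real.exp_pos _)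
  have hs2 : 2 ≤ s := by
    have h : Real.exp 1 ≤ s := (Real.le_log_iff_exp_le hmax).2 (le_max_right _ _)
    linarith [Real.add_one_le_exp (1 : ℝ)]
  have hks : (k : ℝ) ≤ s := by
    have h4 : (k : ℝ) * Real.log 4 ≤ s := by
      rw [← Real.log_pow]
      exact Real.log_le_log (by positivity) (hx.trans (le_max_left _ _))
    have hl4 : 1 ≤ Real.log 4 := by
      rw [Real.le_log_iff_exp_le (by norm_num)]
      linarith [Real.exp_one_lt_d9]
    nlinarith [(Nat.cast_nonneg k : (0 : ℝ) ≤ k)]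
  have hl : Real.log s = lnlnPlus x := rfl
  calc Real.log ((k + 1) * (k + 2)) ≤ Real.log ((2 * s) ^ 2) := by
        refine Real.log_le_log (by positivity) ?_
        nlinarith [(Nat.cast_nonneg k : (0 : ℝ) ≤ k)]
    _ = 2 * (Real.log 2 + lnlnPlus x) := by
        rw [Real.log_pow, Real.log_mul (by norm_num) (by linarith), hl]
        norm_num
    _ ≤ 4 * lnlnPlus x := by
        linarith [one_le_lnlnPlus x, Real.log_le_sub_one_of_pos (show (0 : ℝ) < 2 by norm_num)]

/-- Optimising a family of linear bounds over dyadic scales. -/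
theorem lt_sqrt_of_forall_scale {S V L T : ℝ} (hS : 3 ≤ S) (hV : V ≤ S) (hL : 0 ≤ L)
    (hLS : 3 * L ≤ S)
    (h : ∀ k : ℕ, T < (1 / 2) ^ (k + 1) * V +
      (L + Real.log ((k + 1) * (k + 2))) / (1 / 2) ^ (k + 1)) :
    T < 9 * √(S * (lnlnPlus S + L)) := by
  set A := lnlnPlus S + L with hA
  have hA1 : 1 ≤ A := by linarith [one_le_lnlnPlus S]
  have hAS : A ≤ S := by linarith [lnlnPlus_le_div_three hS]
  set r := √(S * A) with hr
  have hS0 : 0 < S := by linarith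
  have hr0 : 0 < r := Real.sqrt_pos.2 (by positivity)
  have hrr : r ^ 2 = S * A := Real.sq_sqrt (by positivity)
  have hrS : r ≤ S := by nlinarith
  -- Here r / S = √(A/S), and k is chosen so that l < r / S ≤ 2l for l = 2^{-(k+1)}.
  obtain ⟨k, hk1, hk2⟩ := exists_nat_pow_near_of_lt_one (x := r / S) (y := 1 / 2) (by positivity)
    ((div_le_one hS0).2 hrS) (by norm_num) (by norm_num)
  set l : ℝ := (1 / 2) ^ (k + 1) with hl
  have hl0 : 0 < l := by positivity
  have hlr : l * S ≤ r := by
    rw [lt_div_iff₀ hS0] at hk1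
    exact hk1.le
  have hrl : r ≤ 2 * l * S := by
    rw [div_le_iff₀ hS0] at hk2
    rwa [hl, pow_succ, show (2 : ℝ) * ((1 / 2) ^ k * (1 / 2)) = (1 / 2) ^ k by ring]
  -- Square 2^k r ≤ S and use r² = SA ≥ S.
  have hk4 : (4 : ℝ) ^ k ≤ S := by
    have h1 : (2 : ℝ) ^ k * r ≤ S := by
      rw [div_le_iff₀ hS0, one_div, inv_pow] at hk2
      calc (2 : ℝ) ^ k * r ≤ 2 ^ k * ((2 ^ k)⁻¹ * S) := by gcongr
        _ = S := by field_simp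
    have h2 : ((2 : ℝ) ^ k) ^ 2 * r ^ 2 ≤ S ^ 2 := by
      rw [← mul_pow]
      exact pow_le_pow_left₀ (by positivity) h1 2
    rw [← pow_mul, mul_comm k 2, pow_mul, show (2 : ℝ) ^ 2 = 4 by norm_num, hrr] at h2
    have h3 : (0 : ℝ) < 4 ^ k := by positivity
    have h4 : (4 : ℝ) ^ k * S ≤ S * S := by nlinarith [mul_pos h3 hS0]
    exact le_of_mul_le_mul_right h4 hS0
  have hnum : L + Real.log ((k + 1) * (k + 2)) ≤ 4 * A := by linarith [log_scale_le hk4]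
  -- From r² = SA and r ≤ 2lS follows A ≤ 2rl, hence 4A / l ≤ 8r. The variance term adds one more r,
  -- giving the factor 9.
  have hquot : (L + Real.log ((k + 1) * (k + 2))) / l ≤ 8 * r := by
    rw [div_le_iff₀ hl0]
    have : r * r ≤ r * (2 * l * S) := mul_le_mul_of_nonneg_left hrl hr0.le
    have h5 : A * S ≤ (2 * r * l) * S := by nlinarith
    linarith [le_of_mul_le_mul_right h5 hS0]
  have hVr : l * V ≤ r := (mul_le_mul_of_nonneg_left hV hl0.le).trans hlr
  linarith [h k]

/-- All that is used about the value of C₀: it is positive and keeps S above both 3 and 3 ln(4/ξ).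
-/
theorem fifteen_add_three_mul_log_le_C₀ {ξ : ℝ} (h0 : 0 < ξ) (h1 : ξ < 1) :
    15 + 3 * Real.log (4 / ξ) ≤ C₀ ξ := by
  have he := Real.exp_one_gt_d9
  have hsq : (7.38 : ℝ) ≤ Real.exp 1 ^ 2 := by nlinarith
  have hmain : 15 ≤ 3 * (Real.exp 1 - 2) * Real.exp 1 ^ 2 := by nlinarith
  have hroot : 1 / 2 ≤ √(1 / 3 : ℝ) := Real.le_sqrt_of_sq_le (by norm_num)
  have hlog : Real.log (4 / ξ) ≤ Real.log (8 / ξ) :=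
    Real.log_le_log (by positivity) (by gcongr; norm_num)
  have hlog0 : 0 ≤ Real.log (4 / ξ) := Real.log_nonneg (by rw [le_div_iff₀ h0]; linarith)
  rw [C₀]
  nlinarith

/-! ### Union bound over the scales -/

section Uniform

variable {Ω : Type*} {mΩ : MeasurableSpace Ω} {μ : Measure Ω} {g : ℕ → Ω → ℝ}

/-- The weights telescope: 1/((k+1)(k+2)) = 1/(k+1) - 1/(k+2). -/
theorem tsum_scale_le {ξ : ℝ} (hξ : 0 < ξ) :
    ∑' k : ℕ, ENNReal.ofReal (ξ / ((k + 1) * (k + 2))) ≤ ENNReal.ofReal ξ := by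
  refine ENNReal.tsum_le_of_sum_range_le fun n ↦ ?_
  rw [← ENNReal.ofReal_sum_of_nonneg fun k _ ↦ by positivity]
  refine ENNReal.ofReal_le_ofReal ?_
  have h : ∑ k ∈ Finset.range n, ξ / (((k : ℝ) + 1) * (k + 2)) = ξ - ξ / (n + 1) := by
    induction n with
    | zero => simp
    | succ n ih =>
      rw [Finset.sum_range_succ, ih]
      push_cast
      field_simp
      ring
  rw [h]
  have : 0 ≤ ξ / ((n : ℝ) + 1) := by positivity
  linarith

/-- A uniform self-normalised bound over all times and all dyadic scales. -/
theorem measure_not_forall_scale_le (hg : ∀ i, Measurable (g i)) (hind : iIndepFun g μ)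
    (hbdd : ∀ i ω, |g i ω| ≤ 1) (hmean : ∀ i, ∫ ω, g i ω ∂μ = 0) {ξ : ℝ} (hξ : 0 < ξ) :
    μ {ω | ¬ ∀ n k : ℕ, |∑ i ∈ Finset.range (n + 1), g i ω| <
      (1 / 2) ^ (k + 1) * ∑ i ∈ Finset.range (n + 1), g i ω ^ 2 +
        (Real.log (2 / ξ) + Real.log ((k + 1) * (k + 2))) / (1 / 2) ^ (k + 1)} ≤
      ENNReal.ofReal ξ := by
  let B : ℝ → ℝ → Set Ω := fun l δ ↦ {ω | ∃ n, Real.log δ⁻¹ ≤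
    l * ∑ i ∈ Finset.range (n + 1), g i ω - l ^ 2 * ∑ i ∈ Finset.range (n + 1), g i ω ^ 2}
  let l : ℕ → ℝ := fun k ↦ (1 / 2) ^ (k + 1)
  -- The factor 1/2 shares the budget between the signs of l.
  let δ : ℕ → ℝ := fun k ↦ ξ / 2 / ((k + 1) * (k + 2))
  have hδ : ∀ k, 0 < δ k := fun k ↦ by positivity
  have hl0 : ∀ k, 0 < l k := fun k ↦ by positivity
  have hl : ∀ k, |l k| ≤ 1 / 2 := fun k ↦ by
    rw [abs_of_pos (hl0 k)]
    exact pow_le_of_le_one (by norm_num) (by norm_num) (Nat.succ_ne_zero k)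
  have hBμ : ∀ {a d : ℝ}, |a| ≤ 1 / 2 → 0 < d → μ (B a d) ≤ ENNReal.ofReal d :=
    fun ha hd ↦ measure_exists_le_mul_sum_sub_le hg hind hbdd hmean ha hd
  calc _ ≤ μ (⋃ k, B (l k) (δ k) ∪ B (-l k) (δ k)) := by
        refine measure_mono fun ω hω ↦ ?_
        simp only [Set.mem_ofPred_eq, not_forall, not_lt] at hω
        obtain ⟨n, k, h⟩ := hω
        refine Set.mem_iUnion.2 ⟨k, ?_⟩
        have hlog : Real.log (δ k)⁻¹ = Real.log (2 / ξ) + Real.log ((k + 1) * (k + 2)) := by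
          rw [← Real.log_mul (by positivity) (by positivity)]
          congr 1
          simp only [δ]
          field_simp
        change l k * _ + _ / l k ≤ _ at h
        rw [← hlog] at h
        have h' := mul_le_mul_of_nonneg_left h (hl0 k).le
        rw [mul_add, mul_div_cancel₀ _ (hl0 k).ne'] at h'
        rcases abs_cases (∑ i ∈ Finset.range (n + 1), g i ω) with ⟨ha, -⟩ | ⟨ha, -⟩
        · rw [ha] at h'
          exact Or.inl ⟨n, by linarith⟩
        · rw [ha] at h'
          exact Or.inr ⟨n, by rw [neg_sq]; linarith⟩
    _ ≤ ∑' k, μ (B (l k) (δ k) ∪ B (-l k) (δ k)) := measure_iUnion_le _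
    _ ≤ ∑' k : ℕ, ENNReal.ofReal (ξ / ((k + 1) * (k + 2))) := by
        refine ENNReal.tsum_le_tsum fun k ↦ (measure_union_le _ _).trans ?_
        refine (add_le_add (hBμ (hl k) (hδ k)) (hBμ (by rw [abs_neg]; exact hl k) (hδ k))).trans ?_
        rw [← ENNReal.ofReal_add (hδ k).le (hδ k).le]
        refine ENNReal.ofReal_le_ofReal (le_of_eq ?_)
        simp only [δ]
        ring
    _ ≤ ENNReal.ofReal ξ := tsum_scale_le hξ

end Uniform

/-! ### Independence and centring of the increments -/

section Increments

variable {Ω : Type*} {mΩ : MeasurableSpace Ω} {μ : Measure Ω} {d : ℕ}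
  {X Y : ℕ → Ω → EuclideanSpace ℝ (Fin d)}

/-- Block i holds the four samples used by increment i: the summand of `Bool ⊕ Bool` selects X or Y,
the Boolean the parity. Writing an index as 2i + b is unique, so the blocks are disjoint. -/
theorem iIndepFun_blocks (hX : ∀ k, Measurable (X k)) (hY : ∀ k, Measurable (Y k))
    (hind : iIndepFun (Sum.elim X Y) μ) :
    iIndepFun (fun i ω (j : Bool ⊕ Bool) ↦
      Sum.elim X Y (Sum.map (2 * i + ·.toNat) (2 * i + ·.toNat) j) ω) μ := by
  refine iIndepFun_curry (κ := fun _ : ℕ ↦ Bool ⊕ Bool)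
    (X := fun i j ↦ Sum.elim X Y (Sum.map (2 * i + ·.toNat) (2 * i + ·.toNat) j)) ?_ ?_
  · rintro i (b | b)
    exacts [hX _, hY _]
  · refine hind.precomp (g := fun p : (_ : ℕ) × (Bool ⊕ Bool) ↦
      Sum.map (2 * p.1 + ·.toNat) (2 * p.1 + ·.toNat) p.2) ?_
    have key : ∀ {i j : ℕ} {b c : Bool}, 2 * i + b.toNat = 2 * j + c.toNat → i = j ∧ b = c := by
      intro i j b c h
      cases b <;> cases c <;> simp at h ⊢ <;> lia
    rintro ⟨i, b | b⟩ ⟨j, c | c⟩ h <;> simp at h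
    all_goals obtain ⟨rfl, rfl⟩ := key h; rfl

theorem iIndepFun_incr (hX : ∀ k, Measurable (X k)) (hY : ∀ k, Measurable (Y k))
    (hind : iIndepFun (Sum.elim X Y) μ) : iIndepFun (incr X Y) μ :=
  (iIndepFun_blocks hX hY hind).comp
    (fun _ z ↦ inner ℝ (z (.inl false) - z (.inr false)) (z (.inl true) - z (.inr true)))
    (fun _ ↦ by fun_prop)

/-- Under equality of the means the increments are centred. -/
theorem integral_incr_eq_zero (hX : ∀ k, Integrable (X k) μ) (hY : ∀ k, Integrable (Y k) μ)
    (hmean : ∀ k, ∫ ω, X k ω ∂μ = ∫ ω, Y k ω ∂μ)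
    (hind : iIndepFun (Sum.elim X Y) μ) (i : ℕ) : ∫ ω, incr X Y i ω ∂μ = 0 := by
  have hpair : IndepFun (fun ω ↦ (X (2 * i) ω, Y (2 * i) ω))
      (fun ω ↦ (X (2 * i + 1) ω, Y (2 * i + 1) ω)) μ :=
    hind.indepFun_prodMk_prodMk₀
      (by rintro (k | k); exacts [(hX k).aemeasurable, (hY k).aemeasurable])
      (.inl (2 * i)) (.inr (2 * i)) (.inl (2 * i + 1)) (.inr (2 * i + 1))
      (by simp) (by simp) (by simp) (by simp)
  have hdiff : IndepFun (fun ω ↦ X (2 * i) ω - Y (2 * i) ω)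
      (fun ω ↦ X (2 * i + 1) ω - Y (2 * i + 1) ω) μ :=
    hpair.comp (φ := fun z : EuclideanSpace ℝ (Fin d) × EuclideanSpace ℝ (Fin d) ↦ z.1 - z.2)
      (ψ := fun z : EuclideanSpace ℝ (Fin d) × EuclideanSpace ℝ (Fin d) ↦ z.1 - z.2)
      (by fun_prop) (by fun_prop)
  have h := hdiff.integral_bilin ((hX _).sub (hY _)) ((hX _).sub (hY _)) (innerSL ℝ)
  rw [integral_sub (hX _) (hY _), hmean, sub_self, map_zero] at h
  exact h

end Increments

end TwoSample

theorem theorem3 :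
    ∃ C₃ : ℝ, 0 < C₃ ∧
      ∀ (d : ℕ) (P Q : Measure (EuclideanSpace ℝ (Fin d)))
        (Ω : Type*) (_ : MeasurableSpace Ω) (μ : Measure Ω) (_ : IsProbabilityMeasure μ)
        (X Y : ℕ → Ω → EuclideanSpace ℝ (Fin d)),
        -- `X_k ∼ P` and `Y_k ∼ Q`, all of them jointly independent
        (∀ k, HasLaw (X k) P μ) →
        (∀ k, HasLaw (Y k) Q μ) →
        iIndepFun (Sum.elim X Y) μ →
        -- the null hypothesis: the means exist and are equal
        Integrable (fun x => x) P →
        Integrable (fun y => y) Q →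
        ∫ x, x ∂P = ∫ y, y ∂Q →
        -- bounded increments
        (∀ i, ∀ᵐ ω ∂μ, |TwoSample.incr X Y i ω| ≤ 1) →
        ∀ ξ : ℝ, 0 < ξ →
          ENNReal.ofReal (1 - ξ) ≤
            μ {ω | ∀ n : ℕ,
              |TwoSample.stat X Y n ω| <
                TwoSample.C₀ ξ +
                  √(2 * TwoSample.empVarStar C₃ ξ X Y n ω *
                    (TwoSample.lnlnPlus (TwoSample.empVarStar C₃ ξ X Y n ω) +
                      Real.log (4 / ξ)))} := by
  -- The factor 9 must be absorbed under the root: 9² = 81 ≤ 2 · 41.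
  refine ⟨41, by norm_num, ?_⟩
  intro d P Q Ω _ μ _ X Y hX hY hind hP hQ hPQ hbdd ξ hξ
  rcases le_or_gt 1 ξ with hξ1 | hξ1
  · simp [ENNReal.ofReal_of_nonpos (sub_nonpos.2 hξ1)]
  -- Pass to measurable versions of the samples and truncate the increments.
  let Xm : ℕ → Ω → EuclideanSpace ℝ (Fin d) := fun k ↦ (hX k).aemeasurable.mk (X k)
  let Ym : ℕ → Ω → EuclideanSpace ℝ (Fin d) := fun k ↦ (hY k).aemeasurable.mk (Y k)
  have hXmeas : ∀ k, Measurable (Xm k) := fun k ↦ (hX k).aemeasurable.measurable_mk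
  have hYmeas : ∀ k, Measurable (Ym k) := fun k ↦ (hY k).aemeasurable.measurable_mk
  have hXeq : ∀ k, X k =ᵐ[μ] Xm k := fun k ↦ (hX k).aemeasurable.ae_eq_mk
  have hYeq : ∀ k, Y k =ᵐ[μ] Ym k := fun k ↦ (hY k).aemeasurable.ae_eq_mk
  have hindm : iIndepFun (Sum.elim Xm Ym) μ :=
    hind.congr (by rintro (k | k); exacts [hXeq k, hYeq k])
  have hXint : ∀ k, Integrable (X k) μ := fun k ↦
    (integrable_map_measure (g := fun x ↦ x) (by rw [(hX k).map_eq]; exact hP.aestronglyMeasurable)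
      (hX k).aemeasurable).1 (by rw [(hX k).map_eq]; exact hP)
  have hYint : ∀ k, Integrable (Y k) μ := fun k ↦
    (integrable_map_measure (g := fun y ↦ y) (by rw [(hY k).map_eq]; exact hQ.aestronglyMeasurable)
      (hY k).aemeasurable).1 (by rw [(hY k).map_eq]; exact hQ)
  have hXY : ∀ k, ∫ ω, X k ω ∂μ = ∫ ω, Y k ω ∂μ := fun k ↦ by
    rw [(hX k).integral_eq, (hY k).integral_eq, hPQ]
  let g : ℕ → Ω → ℝ := fun i ω ↦ max (-1) (min 1 (TwoSample.incr Xm Ym i ω))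
  have hgm : ∀ i, Measurable (g i) := fun i ↦ by
    have := hXmeas (2 * i); have := hYmeas (2 * i)
    have := hXmeas (2 * i + 1); have := hYmeas (2 * i + 1)
    simp only [g, TwoSample.incr]
    fun_prop
  have hgind : iIndepFun g μ := (TwoSample.iIndepFun_incr hXmeas hYmeas hindm).comp
    (fun _ x ↦ max (-1) (min 1 x)) (fun _ ↦ by fun_prop)
  have hgb : ∀ i ω, |g i ω| ≤ 1 := fun i ω ↦
    abs_le.2 ⟨le_max_left _ _, max_le (by norm_num) (min_le_left _ _)⟩
  have hgincr : ∀ i, TwoSample.incr X Y i =ᵐ[μ] g i := fun i ↦ by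
    filter_upwards [hbdd i, hXeq (2 * i), hYeq (2 * i), hXeq (2 * i + 1), hYeq (2 * i + 1)]
      with ω hb h1 h2 h3 h4
    have he : TwoSample.incr Xm Ym i ω = TwoSample.incr X Y i ω := by
      simp only [TwoSample.incr, h1, h2, h3, h4]
    simp only [g, he, min_eq_right (abs_le.1 hb).2, max_eq_right (abs_le.1 hb).1]
  have hgmean : ∀ i, ∫ ω, g i ω ∂μ = 0 := fun i ↦ by
    rw [← integral_congr_ae (hgincr i)]
    exact TwoSample.integral_incr_eq_zero hXint hYint hXY hind i
  have hbad := TwoSample.measure_not_forall_scale_le hgm hgind hgb hgmean hξ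
  have hC := TwoSample.fifteen_add_three_mul_log_le_C₀ hξ hξ1
  have hlog2 : Real.log (2 / ξ) ≤ Real.log (4 / ξ) :=
    Real.log_le_log (by positivity) (by gcongr; norm_num)
  have hL : 0 ≤ Real.log (4 / ξ) := Real.log_nonneg (by rw [le_div_iff₀ hξ]; linarith)
  set good : Set Ω := {ω | ∀ n : ℕ, |TwoSample.stat X Y n ω| < TwoSample.C₀ ξ +
    √(2 * TwoSample.empVarStar 41 ξ X Y n ω *
      (TwoSample.lnlnPlus (TwoSample.empVarStar 41 ξ X Y n ω) + Real.log (4 / ξ)))} with hgood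
  have hcompl : μ goodᶜ ≤ ENNReal.ofReal ξ := by
    refine (measure_mono_ae ?_).trans hbad
    filter_upwards [ae_all_iff.2 hgincr] with ω hω
    refine fun hnot hall ↦ hnot fun n ↦ ?_
    cases n with
    -- The scale bounds cover only nonempty sums; the empty one needs just C₀ > 0.
    | zero =>
      have := Real.sqrt_nonneg (2 * TwoSample.empVarStar 41 ξ X Y 0 ω *
        (TwoSample.lnlnPlus (TwoSample.empVarStar 41 ξ X Y 0 ω) + Real.log (4 / ξ)))
      simp only [TwoSample.stat, Finset.range_zero, Finset.sum_empty, abs_zero]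
      linarith
    | succ n =>
      set V := TwoSample.empVar X Y (n + 1) ω with hV
      have hV0 : 0 ≤ V := Finset.sum_nonneg fun i _ ↦ sq_nonneg _
      set S := V + TwoSample.C₀ ξ with hS
      have hT : |TwoSample.stat X Y (n + 1) ω| <
          9 * √(S * (TwoSample.lnlnPlus S + Real.log (4 / ξ))) := by
        refine TwoSample.lt_sqrt_of_forall_scale (V := V) (by linarith) (by linarith) hL
          (by linarith) fun k ↦ ?_
        have hnk := hall n k
        simp only [← hω] at hnk
        refine hnk.trans_le ?_
        change _ ≤ (1 / 2) ^ (k + 1) * (∑ i ∈ Finset.range (n + 1), TwoSample.incr X Y i ω ^ 2) + _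
        gcongr
      have hstar : TwoSample.empVarStar 41 ξ X Y (n + 1) ω = 41 * S := rfl
      rw [hstar]
      have hmono : TwoSample.lnlnPlus S ≤ TwoSample.lnlnPlus (41 * S) :=
        TwoSample.lnlnPlus_mono (by linarith)
      have hl1 := TwoSample.one_le_lnlnPlus S
      have hle : 9 * √(S * (TwoSample.lnlnPlus S + Real.log (4 / ξ))) ≤
          √(2 * (41 * S) * (TwoSample.lnlnPlus (41 * S) + Real.log (4 / ξ))) := by
        rw [show (9 : ℝ) = √81 by rw [show (81 : ℝ) = 9 ^ 2 by norm_num]; simp,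
          ← Real.sqrt_mul (by norm_num)]
        refine Real.sqrt_le_sqrt ?_
        rw [← mul_assoc]
        exact mul_le_mul (by linarith) (by linarith) (by linarith) (by linarith)
      linarith
  have htotal : 1 ≤ μ good + μ goodᶜ := by
    rw [← measure_univ (μ := μ), ← Set.union_compl_self good]
    exact measure_union_le _ _
  rw [ENNReal.ofReal_sub _ hξ.le, ENNReal.ofReal_one]
  exact tsub_le_iff_right.2 (htotal.trans (by gcongr))
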